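/- For a set $C\subseteq\mathbb N$ let $\mathcal F_C=\mathbb{Q}(\sqrt{p_n} : n\in C)\subseteq\mathbb R$, where $p_0=2,\ p_1=3,\ p_2=5,\dots$ are the primes in increasing order. A computable presentation of a field identifies its elements with the elements of a computable set of natural numbers so that addition and multiplication become computable functions; a field equipped with such a presentation is a computable field, and a map between computable fields is computable if it is induced by a computable function on the representing numbers. A Rabin embedding of a computable field $\mathcal F$ is a computable field embedding $\imath\colon\mathcal F\to\overline{\mathcal F}$ into a computable algebraically closed field $\overline{\mathcal F}$ that is algebraic over $\imath(\mathcal F)$. A computable field $\mathcal F$ has the computable extendability of automorphisms property if for every computable automorphism $\alpha$ of $\mathcal F$ there are a Rabin embedding $\imath\colon\mathcal F\to\overline{\mathcal F}$ and a computable automorphism $\beta$ of $\overline{\mathcal F}$ such that $\beta\circ\imath=\imath\circ\alpha$. Proposition. For every noncomputable c.e. set $C\subseteq\mathbb N$, the field $\mathcal F_C$ has a computable presentation, and no computable presentation of $\mathcal F_C$ has the computable extendability of automorphisms property. -/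

import Mathlib

/-- A computable presentation of a field `K`: its elements are identified with the elements of a
computable set of natural numbers in such a way that addition and multiplication become computable
functions. (The constants, and by unbounded search also negation and inversion, are then computable
as well.) A computable field is a field together with such a presentation. -/
structure ComputablePresentation (K : Type) [Field K] where
  /-- The natural number that represents an element. -/
  code : K → ℕ
  code_injective : Function.Injective code
  computable_domain : ComputablePred fun n : ℕ => n ∈ Set.range code
  computable_add :
    ∃ f : ℕ → ℕ → ℕ, Computable₂ f ∧ ∀ x y : K, f (code x) (code y) = code (x + y)
  computable_mul :
    ∃ f : ℕ → ℕ → ℕ, Computable₂ f ∧ ∀ x y : K, f (code x) (code y) = code (x * y)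

/-- A map between computable fields is computable if some computable function on the natural
numbers induces it on codes. (As the domain is a computable set, it makes no difference whether
that function is total or only defined on the codes.) -/
def IsComputableMap {K L : Type} [Field K] [Field L]
    (P : ComputablePresentation K) (Q : ComputablePresentation L) (f : K → L) : Prop :=
  ∃ g : ℕ → ℕ, Computable g ∧ ∀ x : K, g (P.code x) = Q.code (f x)

/-- A Rabin embedding of a computable field `K` is a computable field embedding `i` of `K` into a
computable algebraically closed field `E` that is algebraic over the image of `i`. -/
structure IsRabinEmbedding {K E : Type} [Field K] [Field E]
    (P : ComputablePresentation K) (Q : ComputablePresentation E) (i : K →+* E) : Prop where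
  computable : IsComputableMap P Q i
  isAlgClosed : IsAlgClosed E
  isAlgebraic : Algebra.IsAlgebraic i.fieldRange E

/-- The computable extendability of automorphisms property of a computable field `K`: for every
computable automorphism `α` of `K` there are a Rabin embedding `i` of `K` into a computable
presentation of its algebraic closure `E` and a computable automorphism `β` of `E` with
`β ∘ i = i ∘ α`. The embedding may depend on `α`. -/
def ComputableExtendabilityOfAutomorphisms {K : Type} [Field K]
    (P : ComputablePresentation K) : Prop :=
  ∀ α : K ≃+* K, IsComputableMap P P α →
    ∃ (E : Type) (_ : Field E) (Q : ComputablePresentation E) (i : K →+* E) (β : E ≃+* E),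
      IsRabinEmbedding P Q i ∧ IsComputableMap Q Q β ∧ ∀ x : K, β (i x) = i (α x)

/-- The field `ℚ(√pₙ : n ∈ C)`, as a subfield of `ℝ`; here `p₀ = 2, p₁ = 3, p₂ = 5, …` are the
primes in increasing order. -/
noncomputable def sqrtPrimeField (C : Set ℕ) : IntermediateField ℚ ℝ :=
  IntermediateField.adjoin ℚ ((fun n : ℕ => Real.sqrt (Nat.nth Nat.Prime n : ℝ)) '' C)

/-!
Write `K = ℚ(√pₙ : n ∈ C)` and let `c` be a computable enumeration of `C`.

*Linear relations.* In a rational linear relation `∑ aᵢ √dᵢ = 0`, the terms whose radicands lie in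
one class modulo squares already cancel: multiply by `√k` and take the trace to `ℚ`, which kills
the square roots of nonsquares (`sum_sqrt_filter_isSquare_eq_zero`). This has two consequences.

* Vanishing of an expression `(∑ √d - ∑ √e) / (k + 1)` is decidable, since after multiplication by
  `√k` the terms of one class are integers (`sqrtSumEq_iff`). The elements of `K` are the values
  of the terms in the `√p_{c s}` and the negated unit fractions, and each such term can be turned
  into an expression of this form, so `K` has a computable presentation.
* Any choice of signs for the generators `√pₙ` comes from an automorphism of `K`, because the sign
  of a monomial depends only on the class of its radicand (`exists_signed_automorphism`).

*Splitting.* A noncomputable c.e. set is a disjoint union of two c.e. sets that no computable set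
separates (`exists_inseparable_splitting`). This is a Friedberg-style construction: when a new
element enters `C`, the least program that has not been treated yet and has already halted on this
element determines the half in which the element is put, so that its output there is wrong. If a
program computed a separation, it would never be treated, so from some stage on every new element
would have to enter before the program halts on it; this bounds the stage of entrance and makes
`C` computable.

*Conclusion.* Let `α` negate the `√pₙ` with `n` in one half and fix those with `n` in the other.
It is computable in every presentation of `K`, as the square roots of `pₙ`, up to sign, can be
found by search and generate `K` together with the rationals. Suppose `β` is a computable
extension of `α` to a computable algebraically closed field. There a square root `zₙ` of `pₙ` can
be found for every `n`, in `C` or not, and it is decidable whether `β zₙ = -zₙ`. The set of `n`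
for which this holds is computable and separates the two halves of `C`, a contradiction.
-/

/-! ### Computability preliminaries -/

/-- Unbounded search for a witness that is known to exist is computable. -/
theorem Computable.natFind {α : Type*} [Primcodable α] {f : α → ℕ → Bool} (hf : Computable₂ f)
    (H : ∀ a, ∃ n, f a n = true) : Computable fun a => Nat.find (H a) := by
  refine (Partrec.rfind hf.partrec₂).of_eq_tot fun a => ?_
  refine Nat.mem_rfind.2 ⟨?_, fun {m} hm => ?_⟩
  · simpa using! Nat.find_spec (H a)
  · simpa using! Nat.find_min (H a) hm

theorem Computable₂.exists_search {α : Type*} [Primcodable α] {f : α → ℕ → Bool}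
    (hf : Computable₂ f) (H : ∀ a, ∃ n, f a n = true) :
    ∃ g : α → ℕ, Computable g ∧ ∀ a, f a (g a) = true :=
  ⟨_, Computable.natFind hf H, fun a => Nat.find_spec (H a)⟩

theorem computablePred_iff_bool {p : ℕ → Prop} :
    ComputablePred p ↔ ∃ f : ℕ → Bool, Computable f ∧ ∀ n, f n = true ↔ p n := by
  rw [ComputablePred.computable_iff]
  constructor
  · rintro ⟨f, hf, rfl⟩
    exact ⟨f, hf, fun n => Iff.rfl⟩
  · rintro ⟨f, hf, h⟩
    exact ⟨f, hf, funext fun n => propext (h n).symm⟩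

theorem computable_beq {α β : Type*} [Primcodable α] [Primcodable β] [DecidableEq β] {f g : α → β}
    (hf : Computable f) (hg : Computable g) : Computable fun a => decide (f a = g a) :=
  (Primrec.eq (α := β)).decide.to_comp.comp hf hg

theorem primrecPred_prime : PrimrecPred Nat.Prime := by
  have hR : PrimrecRel fun m p : ℕ => ¬ p % m = 0 ∨ m = 1 :=
    ((Primrec.eq.comp (Primrec.nat_mod.comp .snd .fst) (.const 0)).not).or
      (Primrec.eq.comp .fst (.const 1))
  have h2 : PrimrecPred fun p : ℕ => 2 ≤ p := Primrec.nat_le.comp (.const 2) .id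
  refine (h2.and (hR.forall_lt.comp .id .id)).of_eq fun p => ?_
  rw [Nat.prime_def_lt]
  simp only [Nat.dvd_iff_mod_eq_zero, id, imp_iff_not_or]

theorem computable_nth_prime : Computable (Nat.nth Nat.Prime) := by
  have hp : Computable fun n : ℕ => decide (Nat.Prime n) := primrecPred_prime.decide.to_comp
  have hcount : Computable (Nat.count Nat.Prime) := by
    have h := Computable.nat_rec (f := fun n : ℕ => n) (g := fun _ : ℕ => 0)
      (h := fun (_ : ℕ) (p : ℕ × ℕ) => p.2 + cond (decide (Nat.Prime p.1)) 1 0)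
      Computable.id (Computable.const 0)
      (Primrec.nat_add.to_comp.comp (Computable.snd.comp Computable.snd)
        (Computable.cond (hp.comp (Computable.fst.comp Computable.snd)) (Computable.const 1)
          (Computable.const 0)))
    refine h.of_eq fun n => ?_
    induction n with
    | zero => simp
    | succ n ih => simpa only [Nat.count_succ, Bool.cond_decide, Nat.add_right_cancel_iff] using ih
  have H : ∀ n, ∃ m, (decide (Nat.Prime m) && decide (Nat.count Nat.Prime m = n)) = true :=
    fun n => ⟨Nat.nth Nat.Prime n, by
      simp [Nat.prime_nth_prime, Nat.count_nth_of_infinite Nat.infinite_setOfPred_prime]⟩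
  have hsearch : Computable₂ fun n m : ℕ =>
      decide (Nat.Prime m) && decide (Nat.count Nat.Prime m = n) :=
    Primrec.and.to_comp.comp (hp.comp .snd) (computable_beq (hcount.comp .snd) .fst)
  obtain ⟨g, hg, hgs⟩ := hsearch.exists_search H
  refine hg.of_eq fun n => ?_
  have h := hgs n
  simp only [Bool.and_eq_true, decide_eq_true_eq] at h
  exact (Nat.nth_count h.1).symm.trans (congrArg _ h.2)

/-- A nonempty c.e. set is the range of a computable function. -/
theorem REPred.exists_computable_range {C : Set ℕ} (hC : REPred fun n => n ∈ C)
    (hne : C.Nonempty) : ∃ c : ℕ → ℕ, Computable c ∧ Set.range c = C := by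
  obtain ⟨n₀, hn₀⟩ := hne
  let f : ℕ →. ℕ := fun n => Part.assert (n ∈ C) fun _ => Part.some 0
  have hpart : Nat.Partrec f := by
    refine Partrec.nat_iff.1 ?_
    refine (Partrec.map hC (Computable.const 0).to₂).of_eq fun n => ?_
    ext; simp [f, eq_comm]
  obtain ⟨e, he⟩ := Nat.Partrec.Code.exists_code.1 hpart
  have hmem : ∀ n, n ∈ C ↔ ∃ k, (e.evaln k n).isSome = true := by
    intro n
    have h0 : n ∈ C ↔ ∃ x, x ∈ e.eval n := by rw [he]; simp [f]
    rw [h0]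
    simp only [Option.isSome_iff_exists, Nat.Partrec.Code.evaln_complete]
    exact exists_comm
  refine ⟨fun m => cond (e.evaln m.unpair.2 m.unpair.1).isSome m.unpair.1 n₀, ?_, ?_⟩
  · have hev : Primrec fun m : ℕ => e.evaln m.unpair.2 m.unpair.1 :=
      Nat.Partrec.Code.primrec_evaln.comp (((Primrec.snd.comp .unpair).pair (.const e)).pair
        (Primrec.fst.comp .unpair))
    exact (Primrec.cond (Primrec.option_isSome.comp hev) (Primrec.fst.comp .unpair)
      (.const n₀)).to_comp
  · ext n
    constructor
    · rintro ⟨m, rfl⟩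
      dsimp only
      cases h : (e.evaln m.unpair.2 m.unpair.1).isSome with
      | false => exact hn₀
      | true => exact (hmem _).2 ⟨_, h⟩
    · intro hn
      obtain ⟨k, hk⟩ := (hmem n).1 hn
      exact ⟨Nat.pair n k, by simp [hk]⟩

/-! ### Splitting a c.e. set into computably inseparable halves -/

/-- The first stage at which the value `c s` is enumerated. -/
def firstStage (c : ℕ → ℕ) (s : ℕ) : ℕ := Nat.find (⟨s, rfl⟩ : ∃ t, c t = c s)

theorem firstStage_spec (c : ℕ → ℕ) (s : ℕ) : c (firstStage c s) = c s :=
  Nat.find_spec (⟨s, rfl⟩ : ∃ t, c t = c s)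

theorem firstStage_congr {c : ℕ → ℕ} {s t : ℕ} (h : c s = c t) :
    firstStage c s = firstStage c t := by
  simp only [firstStage, h]

theorem computable_firstStage {c : ℕ → ℕ} (hc : Computable c) : Computable (firstStage c) := by
  refine (Computable.natFind (f := fun s t => decide (c t = c s)) ?_
    fun s => ⟨s, by simp⟩).of_eq fun s => ?_
  · exact computable_beq (hc.comp .snd) (hc.comp .fst)
  · simp [firstStage]

/-- `requirementAt L s n` is the least `e ≤ s` outside the list `L` of requirements already met
for which the `e`-th program halts on input `n` within `s` steps; it is `s + 1` if there is none. -/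
def requirementAt (L : List ℕ) (s n : ℕ) : ℕ :=
  (List.range (s + 1)).findIdx fun e =>
    !decide (e ∈ L) && ((Denumerable.ofNat Nat.Partrec.Code e).evaln s n).isSome

theorem requirementAt_spec {L : List ℕ} {s n : ℕ} (h : requirementAt L s n ≤ s) :
    requirementAt L s n ∉ L ∧
      ((Denumerable.ofNat Nat.Partrec.Code (requirementAt L s n)).evaln s n).isSome = true := by
  unfold requirementAt at h ⊢
  have hlt := lt_of_lt_of_eq (Nat.lt_succ_of_le h) (List.length_range (n := s + 1)).symm
  have hq := List.findIdx_getElem (w := hlt)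
  rw [Bool.and_eq_true, Bool.not_eq_true', decide_eq_false_iff_not] at hq
  simpa only [List.getElem_range] using hq

theorem requirementAt_le {L : List ℕ} {s n e : ℕ} (heL : e ∉ L)
    (he : ((Denumerable.ofNat Nat.Partrec.Code e).evaln s n).isSome = true) :
    requirementAt L s n ≤ e := by
  by_contra! hlt
  have := List.not_of_lt_findIdx hlt
  rw [List.getElem_range] at this
  simp [heL, he] at this

theorem primrec_requirementAt :
    Primrec fun p : List ℕ × ℕ × ℕ => requirementAt p.1 p.2.1 p.2.2 := by
  have hmem : PrimrecRel fun (L : List ℕ) (e : ℕ) => e ∈ L :=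
    (PrimrecRel.exists_mem_list (R := fun a b : ℕ => a = b) Primrec.eq).of_eq fun L e => by simp
  refine Primrec.list_findIdx (Primrec.list_range.comp (Primrec.succ.comp
    (Primrec.fst.comp .snd))) ?_
  refine Primrec.and.comp (Primrec.not.comp (hmem.comp (Primrec.fst.comp .fst) .snd).decide) ?_
  exact Primrec.option_isSome.comp (Nat.Partrec.Code.primrec_evaln.comp
    (((Primrec.fst.comp (Primrec.snd.comp .fst)).pair ((Primrec.ofNat _).comp .snd)).pair
      (Primrec.snd.comp (Primrec.snd.comp .fst))))

/-- The list of requirements met before stage `s` of the enumeration `c`. A stage which repeats an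
earlier value of `c` is idle. -/
def metRequirements (c : ℕ → ℕ) : ℕ → List ℕ
  | 0 => []
  | s + 1 =>
    cond (decide (firstStage c s = s) &&
        decide (requirementAt (metRequirements c s) s (c s) ≤ s))
      (requirementAt (metRequirements c s) s (c s) :: metRequirements c s) (metRequirements c s)

theorem computable_metRequirements {c : ℕ → ℕ} (hc : Computable c) :
    Computable (metRequirements c) := by
  have hargs : Computable fun p : ℕ × ℕ × List ℕ => (p.2.2, p.2.1, c p.2.1) :=
    (Computable.snd.comp .snd).pair
      ((Computable.fst.comp .snd).pair (hc.comp (Computable.fst.comp .snd)))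
  have hreq : Computable fun p : ℕ × ℕ × List ℕ => requirementAt p.2.2 p.2.1 (c p.2.1) :=
    (primrec_requirementAt.to_comp.comp hargs :)
  have hstage : Computable fun p : ℕ × ℕ × List ℕ => p.2.1 := Computable.fst.comp .snd
  have hfirst : Computable fun p : ℕ × ℕ × List ℕ => firstStage c p.2.1 :=
    (computable_firstStage hc).comp hstage
  have hfresh : Computable fun p : ℕ × ℕ × List ℕ => decide (firstStage c p.2.1 = p.2.1) :=
    computable_beq hfirst hstage
  have hle : Computable fun p : ℕ × ℕ × List ℕ =>
      decide (requirementAt p.2.2 p.2.1 (c p.2.1) ≤ p.2.1) :=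
    Primrec.nat_le.decide.to_comp.comp hreq hstage
  have hstep : Computable₂ fun (_ : ℕ) (p : ℕ × List ℕ) =>
      cond (decide (firstStage c p.1 = p.1) && decide (requirementAt p.2 p.1 (c p.1) ≤ p.1))
        (requirementAt p.2 p.1 (c p.1) :: p.2) p.2 :=
    Computable.cond (Primrec.and.to_comp.comp hfresh hle)
      (Computable.list_cons.comp hreq (Computable.snd.comp .snd)) (Computable.snd.comp .snd)
  refine (Computable.nat_rec Computable.id (Computable.const []) hstep).of_eq fun n => ?_
  induction n with
  | zero => rfl
  | succ n ih =>
    rw [metRequirements, ← ih]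
    rfl

theorem metRequirements_mono (c : ℕ → ℕ) {s t : ℕ} (h : s ≤ t) :
    metRequirements c s ⊆ metRequirements c t := by
  induction t, h using Nat.le_induction with
  | base => exact List.Subset.refl _
  | succ t _ ih =>
    refine List.Subset.trans ih ?_
    rw [metRequirements]
    cases decide (firstStage c t = t) && decide (requirementAt (metRequirements c t) t (c t) ≤ t)
    · exact List.Subset.refl _
    · exact List.subset_cons_self _ _

/-- The half of the splitting into which the value `c s` is put: it is chosen at the first stage
that enumerates the value, so as to disagree with the program that is being diagonalized against.
Programs output `0` for `false` and `1` for `true`. -/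
def splitSide (c : ℕ → ℕ) (s : ℕ) : Bool :=
  decide ((Denumerable.ofNat Nat.Partrec.Code
    (requirementAt (metRequirements c (firstStage c s)) (firstStage c s) (c s))).evaln
      (firstStage c s) (c s) = some 0)

theorem computable_splitSide {c : ℕ → ℕ} (hc : Computable c) : Computable (splitSide c) := by
  have h1 := computable_firstStage hc
  refine computable_beq ?_ (Computable.const _)
  exact Nat.Partrec.Code.primrec_evaln.to_comp.comp
    ((h1.pair ((Computable.ofNat _).comp (primrec_requirementAt.to_comp.comp
      (((computable_metRequirements hc).comp h1).pair (h1.pair hc))))).pair hc)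

/-- If program `e` computes a separation `D` of the two halves, then it is never diagonalized
against. -/
theorem not_mem_metRequirements {c : ℕ → ℕ} {D : ℕ → Bool} {e : ℕ}
    (he : ∀ n, (Denumerable.ofNat Nat.Partrec.Code e).eval n = Part.some (D n).toNat)
    (hD : ∀ s, D (c s) = splitSide c s) (s : ℕ) : e ∉ metRequirements c s := by
  induction s with
  | zero => simp [metRequirements]
  | succ s ih =>
    rw [metRequirements]
    cases hc : decide (firstStage c s = s) &&
      decide (requirementAt (metRequirements c s) s (c s) ≤ s) with
    | false => exact ih
    | true =>
      simp only [Bool.and_eq_true, decide_eq_true_eq] at hc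
      obtain ⟨h1, h2⟩ := hc
      simp only [cond_true, List.mem_cons, not_or]
      refine ⟨fun h => ?_, ih⟩
      obtain ⟨v, hv⟩ := Option.isSome_iff_exists.1 (requirementAt_spec h2).2
      rw [← h] at hv
      have hv' := Nat.Partrec.Code.evaln_sound (Option.mem_def.2 hv)
      rw [he, Part.mem_some_iff] at hv'
      have := hD s
      rw [splitSide, h1, ← h, hv, hv'] at this
      cases h3 : D (c s) <;> simp [h3] at this

/-- Below any bound, only finitely many stages are spent on meeting requirements. -/
theorem exists_forall_requirementAt_ge (c : ℕ → ℕ) (e : ℕ) :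
    ∃ s₀, ∀ s ≥ s₀, firstStage c s = s →
      requirementAt (metRequirements c s) s (c s) ≤ s →
      e ≤ requirementAt (metRequirements c s) s (c s) := by
  induction e with
  | zero => exact ⟨0, fun _ _ _ _ => Nat.zero_le _⟩
  | succ e ih =>
    obtain ⟨s₀, h₀⟩ := ih
    by_cases h : ∃ s₁, e ∈ metRequirements c s₁
    · obtain ⟨s₁, h₁⟩ := h
      refine ⟨max s₀ s₁, fun s hs hf hr => ?_⟩
      refine Nat.succ_le_of_lt (lt_of_le_of_ne (h₀ s (le_trans (le_max_left _ _) hs) hf hr) ?_)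
      intro he
      refine (requirementAt_spec hr).1 ?_
      rw [← he]
      exact metRequirements_mono c (le_trans (le_max_right s₀ s₁) hs) h₁
    · push Not at h
      refine ⟨s₀, fun s hs hf hr => ?_⟩
      refine Nat.succ_le_of_lt (lt_of_le_of_ne (h₀ s hs hf hr) ?_)
      intro he
      refine h (s + 1) ?_
      rw [metRequirements]
      simp [hf, ← he, he ▸ hr]

/-- Every noncomputable c.e. set splits into two computably inseparable halves. Here `c` enumerates
the set and `σ s` tells to which half `c s` belongs. -/
theorem exists_inseparable_splitting {C : Set ℕ} (hCe : REPred fun n => n ∈ C)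
    (hnc : ¬ ComputablePred fun n => n ∈ C) :
    ∃ (c : ℕ → ℕ) (σ : ℕ → Bool), Computable c ∧ Set.range c = C ∧ Computable σ ∧
      (∀ s t, c s = c t → σ s = σ t) ∧
      ∀ D : ℕ → Bool, Computable D → ∃ s, D (c s) ≠ σ s := by
  have hne : C.Nonempty := by
    rw [Set.nonempty_iff_ne_empty]
    rintro rfl
    exact hnc (computablePred_iff_bool.2 ⟨fun _ => false, Computable.const _, by simp⟩)
  obtain ⟨c, hc, rfl⟩ := hCe.exists_computable_range hne
  refine ⟨c, splitSide c, hc, rfl, computable_splitSide hc, fun s t h => ?_, fun D hDc => ?_⟩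
  · simp only [splitSide, h, firstStage_congr h]
  by_contra! hD
  apply hnc
  have hDn : Computable fun n => (D n).toNat := (Primrec.dom_bool Bool.toNat).to_comp.comp hDc
  obtain ⟨e', he'⟩ := Nat.Partrec.Code.exists_code.1 (Partrec.nat_iff.1 hDn.partrec)
  obtain ⟨e, rfl⟩ : ∃ e, Denumerable.ofNat Nat.Partrec.Code e = e' :=
    ⟨Encodable.encode e', Denumerable.ofNat_encode e'⟩
  have he : ∀ n, (Denumerable.ofNat Nat.Partrec.Code e).eval n = Part.some (D n).toNat :=
    fun n => by rw [he']; rfl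
  have hnot := not_mem_metRequirements he hD
  obtain ⟨s₀, hs₀⟩ := exists_forall_requirementAt_ge c (e + 1)
  have H : ∀ n, ∃ k, ((Denumerable.ofNat Nat.Partrec.Code e).evaln k n).isSome = true := fun n => by
    have : (D n).toNat ∈ (Denumerable.ofNat Nat.Partrec.Code e).eval n := by simp [he]
    obtain ⟨k, hk⟩ := Nat.Partrec.Code.evaln_complete.1 this
    exact ⟨k, Option.isSome_iff_exists.2 ⟨_, hk⟩⟩
  have hsearch : Computable₂ fun n k : ℕ =>
      ((Denumerable.ofNat Nat.Partrec.Code e).evaln k n).isSome :=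
    (Primrec.option_isSome.comp (Nat.Partrec.Code.primrec_evaln.comp
      ((Primrec.snd.pair (.const _)).pair .fst))).to_comp
  obtain ⟨T, hT, hTs⟩ := hsearch.exists_search H
  -- From stage `s₀` on no requirement `≤ e` is met, so a new value enters before program `e` halts
  -- on it.
  have key : ∀ n, n ∈ Set.range c ↔ ∃ j < s₀ + e + T n, c j = n := by
    intro n
    refine ⟨?_, fun ⟨j, _, hj⟩ => ⟨j, hj⟩⟩
    rintro ⟨s', rfl⟩
    refine ⟨firstStage c s', ?_, firstStage_spec c s'⟩
    set s := firstStage c s' with hs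
    have hcs : c s = c s' := firstStage_spec c s'
    have hfs : firstStage c s = s := firstStage_congr hcs
    by_contra! hle
    have hspec := hTs (c s')
    obtain ⟨v, hv⟩ := Option.isSome_iff_exists.1 hspec
    have hv' := Nat.Partrec.Code.evaln_mono (k₂ := s) (by omega) (Option.mem_def.2 hv)
    rw [← hcs] at hv'
    have hle' : requirementAt (metRequirements c s) s (c s) ≤ e :=
      requirementAt_le (hnot s) (Option.isSome_iff_exists.2 ⟨v, hv'⟩)
    have := hs₀ s (by omega) hfs (by omega)
    omega
  have hdec : Computable₂ fun n b => Nat.rec (motive := fun _ => Bool) false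
      (fun j r => r || decide (c j = n)) b := by
    refine Computable.nat_rec (f := fun p : ℕ × ℕ => p.2) (g := fun _ => false)
      (h := fun (p : ℕ × ℕ) (q : ℕ × Bool) => q.2 || decide (c q.1 = p.1)) .snd (.const _) ?_
    exact Primrec.or.to_comp.comp (Computable.snd.comp .snd)
      (computable_beq (hc.comp (Computable.fst.comp .snd)) (Computable.fst.comp .fst))
  have hdec' : ∀ n b, Nat.rec (motive := fun _ => Bool) false
      (fun j r => r || decide (c j = n)) b = true ↔ ∃ j < b, c j = n := by
    intro n b
    induction b with
    | zero => simp
    | succ b ih => 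
      simp only [Bool.or_eq_true, decide_eq_true_eq, Nat.lt_succ_iff_lt_or_eq, or_and_right,
        exists_or, exists_eq_left]
      exact or_congr_left ih
  refine computablePred_iff_bool.2 ⟨_, hdec.comp Computable.id
    (Primrec.nat_add.to_comp.comp (Computable.const (s₀ + e)) hT), fun n => ?_⟩
  rw [key n]
  exact hdec' n _

/-! ### Rational linear relations between square roots -/

theorem trace_eq_zero_of_sq_eq {K : Type*} [Field K] [Algebra ℚ K] [FiniteDimensional ℚ K] {x : K}
    {m : ℕ} (hx : x ^ 2 = m) (hm : ¬ IsSquare m) : Algebra.trace ℚ K x = 0 := by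
  have hirr : Irreducible (Polynomial.X ^ 2 - Polynomial.C (m : ℚ)) := by
    refine X_pow_sub_C_irreducible_of_prime Nat.prime_two fun b hb => hm ?_
    rw [← Rat.isSquare_natCast_iff]
    exact ⟨b, by rw [← hb, sq]⟩
  have hmin : Polynomial.X ^ 2 - Polynomial.C (m : ℚ) = minpoly ℚ x :=
    minpoly.eq_of_irreducible_of_monic hirr (by simp [hx])
      (Polynomial.monic_X_pow_sub_C _ two_ne_zero)
  rw [trace_eq_finrank_mul_minpoly_nextCoeff, ← hmin,
    Polynomial.nextCoeff_of_natDegree_pos (by rw [Polynomial.natDegree_X_pow_sub_C]; norm_num),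
    Polynomial.natDegree_X_pow_sub_C]
  simp

/-- In a rational linear relation between square roots, the terms whose radicands lie in one class
modulo squares already cancel. Indeed the trace to `ℚ` kills the square root of a nonsquare. -/
theorem sum_sqrt_filter_isSquare_eq_zero {ι : Type*} (s : Finset ι) (a : ι → ℚ) (d : ι → ℕ)
    (h : ∑ i ∈ s, (a i : ℝ) * √(d i) = 0) (k : ℕ) :
    ∑ i ∈ s with IsSquare (d i * k), (a i : ℝ) * √(d i * k : ℕ) = 0 := by
  classical
  let S : Set ℝ := (fun i => √(d i * k : ℕ)) '' s
  let K := IntermediateField.adjoin ℚ S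
  have hint : ∀ x ∈ S, IsIntegral ℚ x := by
    rintro _ ⟨i, _, rfl⟩
    refine IsIntegral.of_pow two_pos ?_
    simp only [Real.sq_sqrt (Nat.cast_nonneg _)]
    exact isIntegral_algebraMap (x := ((d i * k : ℕ) : ℚ))
  have : Finite S := (s.finite_toSet.image _).to_subtype
  have : FiniteDimensional ℚ K := IntermediateField.finiteDimensional_adjoin hint
  let x : s → K := fun i =>
    ⟨√(d i * k : ℕ), IntermediateField.subset_adjoin ℚ S ⟨i, i.2, rfl⟩⟩
  have hx : ∀ i, x i ^ 2 = (d i * k : ℕ) := fun i => by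
    apply Subtype.ext
    simpa [x] using Real.sq_sqrt (Nat.cast_nonneg (d i * k))
  have hsum : ∑ i : s, a i • x i = 0 := by
    apply Subtype.ext
    have : ∑ i ∈ s, (a i : ℝ) * √(d i * k : ℕ) = 0 := by
      rw [← zero_mul √k, ← h, Finset.sum_mul]
      refine Finset.sum_congr rfl fun i _ => ?_
      rw [Nat.cast_mul, Real.sqrt_mul (Nat.cast_nonneg _), mul_assoc]
    rw [← Finset.sum_coe_sort] at this
    refine Eq.trans ?_ this
    simp [x, Rat.smul_def]
  have htr := congrArg (Algebra.trace ℚ K) hsum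
  rw [map_sum, map_zero] at htr
  have hterm : ∀ i : s, ((Algebra.trace ℚ K (a i • x i) : ℚ) : ℝ) = Module.finrank ℚ K *
      if IsSquare (d i * k) then (a i : ℝ) * √(d i * k : ℕ) else 0 := by
    intro i
    rw [map_smul]
    split_ifs with hs
    · obtain ⟨r, hr⟩ := hs
      have hxr : x i = algebraMap ℚ K r := by
        apply Subtype.ext
        simp only [x, hr]
        push_cast
        rw [Real.sqrt_mul_self (Nat.cast_nonneg _)]
      rw [hxr, Algebra.trace_algebraMap, hr]
      push_cast
      rw [Real.sqrt_mul_self (Nat.cast_nonneg _)]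
      simp only [nsmul_eq_mul, smul_eq_mul]
      push_cast
      ring
    · rw [trace_eq_zero_of_sq_eq (hx i) hs]
      simp
  have hcast := congrArg (fun q : ℚ => (q : ℝ)) htr
  simp only [Rat.cast_sum, Rat.cast_zero, hterm, ← Finset.mul_sum] at hcast
  have hpos : (Module.finrank ℚ K : ℝ) ≠ 0 := by
    exact_mod_cast (Module.finrank_pos (R := ℚ) (M := K)).ne'
  rw [Finset.sum_filter, ← Finset.sum_coe_sort]
  exact (mul_eq_zero.1 hcast).resolve_left hpos

/-- A sum vanishes as soon as its part over each class of radicands modulo squares vanishes. The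
radicand `0`, for which classes are not disjoint, has to contribute nothing. -/
theorem sum_eq_zero_of_forall_isSquare {ι : Type*} (s : Finset ι) (f : ι → ℝ) (d : ι → ℕ)
    (hf : ∀ i, d i = 0 → f i = 0)
    (h : ∀ i ∈ s, d i ≠ 0 → ∑ j ∈ s with IsSquare (d j * d i), f j = 0) : ∑ i ∈ s, f i = 0 := by
  classical
  let R : Setoid ι :=
    { r := fun i j => (d i = 0 ↔ d j = 0) ∧ IsSquare (d i * d j)
      iseqv := ⟨fun i => ⟨Iff.rfl, _, rfl⟩, fun h => ⟨h.1.symm, mul_comm (d _) _ ▸ h.2⟩,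
        fun {i j k} hij hjk => by
          refine ⟨hij.1.trans hjk.1, ?_⟩
          by_cases hj : d j = 0
          · rw [hij.1.2 hj, zero_mul]
            exact IsSquare.zero
          have h1 := Rat.isSquare_natCast_iff.2 hij.2
          have h2 := Rat.isSquare_natCast_iff.2 hjk.2
          rw [← Rat.isSquare_natCast_iff]
          have hj' : (d j : ℚ) ≠ 0 := Nat.cast_ne_zero.2 hj
          have hdiv : ((d i * d k : ℕ) : ℚ) = (d i * d j : ℕ) * (d j * d k : ℕ) / (d j * d j) := by
            push_cast
            field_simp
          rw [hdiv]
          exact (h1.mul h2).div (IsSquare.mul_self _)⟩ }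
  refine Finset.sum_cancels_of_partition_cancels R fun i hi => ?_
  by_cases hi0 : d i = 0
  · exact Finset.sum_eq_zero fun j hj => hf j ((Finset.mem_filter.1 hj).2.1.2 hi0)
  · rw [← h i hi hi0, Finset.sum_filter, Finset.sum_filter]
    refine Finset.sum_congr rfl fun j _ => ?_
    by_cases hj0 : d j = 0
    · simp [hf j hj0]
    · have : R j i ↔ IsSquare (d j * d i) := and_iff_right (iff_of_false hj0 hi0)
      simp only [this]

/-! ### Automorphisms of the field generated by square roots of primes -/

/-- The generator `√pₙ` of `ℚ(√pₙ : n ∈ C)`. -/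
noncomputable def sqrtPrime {C : Set ℕ} (n : C) : sqrtPrimeField C :=
  ⟨√(Nat.nth Nat.Prime n), IntermediateField.subset_adjoin ℚ _ ⟨n, n.2, rfl⟩⟩

theorem coe_sqrtPrime {C : Set ℕ} (n : C) : (sqrtPrime n : ℝ) = √(Nat.nth Nat.Prime n) := rfl

theorem sqrtPrime_mul_self {C : Set ℕ} (n : C) :
    sqrtPrime n * sqrtPrime n = (Nat.nth Nat.Prime n : ℕ) :=
  Subtype.ext (by simp [coe_sqrtPrime])

/-- The generator `√p_{c s}` given by the `s`-th entry of an enumeration `c`. -/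
noncomputable def enumSqrt (c : ℕ → ℕ) (s : ℕ) : sqrtPrimeField (Set.range c) :=
  sqrtPrime ⟨c s, s, rfl⟩

theorem enumSqrt_mul_self (c : ℕ → ℕ) (s : ℕ) :
    enumSqrt c s * enumSqrt c s = (Nat.nth Nat.Prime (c s) : ℕ) :=
  sqrtPrime_mul_self _

theorem exists_enumSqrt_eq {c : ℕ → ℕ} (n : Set.range c) : ∃ s, enumSqrt c s = sqrtPrime n := by
  obtain ⟨_, s, rfl⟩ := n
  exact ⟨s, rfl⟩

theorem sqrtPrimeField_induction {C : Set ℕ} {motive : sqrtPrimeField C → Prop}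
    (sqrt : ∀ n, motive (sqrtPrime n)) (rat : ∀ q : ℚ, motive q)
    (add : ∀ x y, motive x → motive y → motive (x + y))
    (mul : ∀ x y, motive x → motive y → motive (x * y)) (x : sqrtPrimeField C) : motive x := by
  obtain ⟨x, hx⟩ := x
  have halg : (sqrtPrimeField C).toSubalgebra = Algebra.adjoin ℚ
      ((fun n : ℕ => √(Nat.nth Nat.Prime n : ℝ)) '' C) := by
    refine IntermediateField.adjoin_toSubalgebra_of_isAlgebraic ?_
    rintro _ ⟨n, _, rfl⟩
    refine IsIntegral.isAlgebraic (IsIntegral.of_pow two_pos ?_)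
    simp only [Real.sq_sqrt (Nat.cast_nonneg _)]
    exact isIntegral_algebraMap (x := (Nat.nth Nat.Prime n : ℚ))
  have hle : ∀ {y}, y ∈ Algebra.adjoin ℚ ((fun n : ℕ => √(Nat.nth Nat.Prime n : ℝ)) '' C) →
      y ∈ sqrtPrimeField C := fun {y} hy => by
    rw [← IntermediateField.mem_toSubalgebra, halg]; exact hy
  have hx' : x ∈ Algebra.adjoin ℚ ((fun n : ℕ => √(Nat.nth Nat.Prime n : ℝ)) '' C) := by
    rw [← halg]; exact hx
  refine Algebra.adjoin_induction (p := fun y hy => motive ⟨y, hle hy⟩) ?_ ?_ ?_ ?_ hx'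
  · rintro _ ⟨n, hn, rfl⟩
    exact sqrt ⟨n, hn⟩
  · intro q
    convert rat q
    simp
  · exact fun y z hy hz => add ⟨y, hle hy⟩ ⟨z, hle hz⟩
  · exact fun y z hy hz => mul ⟨y, hle hy⟩ ⟨z, hle hz⟩

/-- The radicand `∏ pₙ ^ m n` belonging to a monomial `m` in the generators. -/
noncomputable def radicand {C : Set ℕ} (m : C →₀ ℕ) : ℕ :=
  ∏ n ∈ m.support, Nat.nth Nat.Prime n ^ m n

theorem radicand_ne_zero {C : Set ℕ} (m : C →₀ ℕ) : radicand m ≠ 0 :=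
  Finset.prod_ne_zero_iff.2 fun i _ => pow_ne_zero _ (Nat.prime_nth_prime i).ne_zero

theorem even_of_isSquare_radicand_mul {C : Set ℕ} {m m' : C →₀ ℕ}
    (h : IsSquare (radicand m * radicand m')) (n : C) : Even (m n + m' n) := by
  have hfac : ∀ m : C →₀ ℕ, (radicand m).factorization (Nat.nth Nat.Prime n) = m n := by
    intro m
    rw [radicand, Nat.factorization_prod fun (i : C) _ =>
      pow_ne_zero _ (Nat.prime_nth_prime i).ne_zero,
      Finsupp.finsetSum_apply, Finset.sum_eq_single n]
    · rw [(Nat.prime_nth_prime n).factorization_pow, Finsupp.single_eq_same]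
    · intro i _ hin
      rw [(Nat.prime_nth_prime i).factorization_pow, Finsupp.single_eq_of_ne]
      exact fun h => hin (Subtype.ext (Nat.nth_injective Nat.infinite_setOfPred_prime h).symm)
    · intro hn
      rw [Finsupp.notMem_support_iff.1 hn]
      simp
  obtain ⟨r, hr⟩ := h
  have hr0 : r ≠ 0 := by
    rintro rfl
    exact mul_ne_zero (radicand_ne_zero m) (radicand_ne_zero m') hr
  have := congrArg (fun k => k.factorization (Nat.nth Nat.Prime n)) hr
  simp only [Nat.factorization_mul (radicand_ne_zero m) (radicand_ne_zero m'),
    Nat.factorization_mul hr0 hr0, Finsupp.add_apply, hfac] at this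
  exact ⟨_, this⟩

theorem sign_eq_of_isSquare_radicand_mul {C : Set ℕ} (ε : C → ℤˣ) {m m' : C →₀ ℕ}
    (h : IsSquare (radicand m * radicand m')) :
    ∏ n ∈ m.support, ε n ^ m n = ∏ n ∈ m'.support, ε n ^ m' n := by
  have hmul : (m.prod fun n k => ε n ^ k) * (m'.prod fun n k => ε n ^ k) = 1 := by
    rw [← Finsupp.prod_add_index' (fun _ => pow_zero _) fun _ => pow_add _]
    refine Finset.prod_eq_one fun n _ => ?_
    obtain ⟨r, hr⟩ := even_of_isSquare_radicand_mul h n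
    dsimp only
    rw [Finsupp.add_apply, hr, pow_add, Int.units_mul_self]
  have := congrArg (· * m'.prod fun n k => ε n ^ k) hmul
  rw [mul_assoc, Int.units_mul_self, mul_one, one_mul] at this
  exact this

/-- Evaluation of polynomials at the generators `√pₙ` with signs `ε`. -/
noncomputable def signedEval {C : Set ℕ} (ε : C → ℤˣ) :
    MvPolynomial C ℚ →ₐ[ℚ] sqrtPrimeField C :=
  MvPolynomial.aeval fun n => ((ε n : ℤ) : sqrtPrimeField C) * sqrtPrime n

theorem coe_signedEval {C : Set ℕ} (ε : C → ℤˣ) (f : MvPolynomial C ℚ) :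
    (signedEval ε f : ℝ) = ∑ m ∈ f.support,
      ((∏ n ∈ m.support, ε n ^ m n : ℤˣ) : ℤ) * (((f.coeff m : ℚ) : ℝ) * √(radicand m)) := by
  rw [signedEval, MvPolynomial.aeval_def, MvPolynomial.eval₂_eq]
  push_cast
  refine Finset.sum_congr rfl fun m _ => ?_
  have : √(radicand m : ℝ) = ∏ n ∈ m.support, √(Nat.nth Nat.Prime n) ^ m n := by
    rw [radicand, Nat.cast_prod, Real.sqrt_prod _ fun _ _ => Nat.cast_nonneg _]
    refine Finset.prod_congr rfl fun n _ => ?_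
    rw [Real.sqrt_eq_iff_mul_self_eq (Nat.cast_nonneg _) (by positivity), ← mul_pow,
      Real.mul_self_sqrt (Nat.cast_nonneg _), Nat.cast_pow]
  rw [this]
  simp only [coe_sqrtPrime, mul_pow, Finset.prod_mul_distrib]
  simp
  ring

theorem signedEval_surjective {C : Set ℕ} : Function.Surjective (signedEval (1 : C → ℤˣ)) := by
  intro x
  induction x using sqrtPrimeField_induction with
  | sqrt n => exact ⟨MvPolynomial.X n, by simp [signedEval]⟩
  | rat q => exact ⟨MvPolynomial.C q, by simp [signedEval]⟩
  | add x y hx hy =>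
    obtain ⟨f, rfl⟩ := hx
    obtain ⟨g, rfl⟩ := hy
    exact ⟨f + g, map_add _ _ _⟩
  | mul x y hx hy =>
    obtain ⟨f, rfl⟩ := hx
    obtain ⟨g, rfl⟩ := hy
    exact ⟨f * g, map_mul _ _ _⟩

theorem ker_signedEval_le {C : Set ℕ} (ε : C → ℤˣ) :
    RingHom.ker (signedEval (1 : C → ℤˣ)) ≤ RingHom.ker (signedEval ε) := by
  classical
  intro f hf
  rw [RingHom.mem_ker] at hf ⊢
  have h1 : ∑ m ∈ f.support, ((f.coeff m : ℚ) : ℝ) * √(radicand m) = 0 := by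
    have := congrArg (fun x : sqrtPrimeField C => (x : ℝ)) hf
    simpa [coe_signedEval] using this
  apply Subtype.ext
  rw [coe_signedEval]
  -- Within a class of radicands modulo squares the sign of a monomial is constant.
  refine sum_eq_zero_of_forall_isSquare _ _ radicand
    (fun m hm => absurd hm (radicand_ne_zero m)) fun m _ _ => ?_
  have hcls := sum_sqrt_filter_isSquare_eq_zero f.support (fun m => f.coeff m) radicand h1
    (radicand m)
  simp only [Nat.cast_mul, Real.sqrt_mul (Nat.cast_nonneg _), ← mul_assoc, ← Finset.sum_mul] at hcls
  have hm0 : √(radicand m : ℝ) ≠ 0 := (Real.sqrt_pos.2 (Nat.cast_pos.2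
    (Nat.pos_of_ne_zero (radicand_ne_zero m)))).ne'
  have hcls' := (mul_eq_zero.1 hcls).resolve_right hm0
  rw [← mul_zero (((∏ n ∈ m.support, ε n ^ m n : ℤˣ) : ℤ) : ℝ), ← hcls', Finset.mul_sum]
  refine Finset.sum_congr rfl fun m' hm' => ?_
  rw [sign_eq_of_isSquare_radicand_mul ε (Finset.mem_filter.1 hm').2]

/-- The signs of the generators `√pₙ` can be prescribed by an automorphism. -/
theorem exists_signed_automorphism {C : Set ℕ} (ε : C → ℤˣ) :
    ∃ α : sqrtPrimeField C ≃+* sqrtPrimeField C,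
      ∀ n, α (sqrtPrime n) = ((ε n : ℤ) : sqrtPrimeField C) * sqrtPrime n := by
  let φ : sqrtPrimeField C →ₐ[ℚ] sqrtPrimeField C :=
    AlgHom.liftOfSurjective _ signedEval_surjective (signedEval ε) (ker_signedEval_le ε)
  have hφ : ∀ n, φ (sqrtPrime n) = ((ε n : ℤ) : sqrtPrimeField C) * sqrtPrime n := by
    intro n
    have h := AlgHom.liftOfSurjective_apply _ signedEval_surjective (signedEval ε)
      (ker_signedEval_le ε) (MvPolynomial.X n)
    have h1 : signedEval (1 : C → ℤˣ) (MvPolynomial.X n) = sqrtPrime n := by simp [signedEval]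
    have h2 : signedEval ε (MvPolynomial.X n) = ((ε n : ℤ) : sqrtPrimeField C) * sqrtPrime n := by
      simp [signedEval]
    rw [h1, h2] at h
    exact h
  have hinv : ∀ x, φ (φ x) = x := by
    intro x
    induction x using sqrtPrimeField_induction with
    | sqrt n =>
      rw [hφ, map_mul, hφ, map_intCast, ← mul_assoc, ← Int.cast_mul, ← Units.val_mul,
        Int.units_mul_self]
      simp
    | rat q => simp
    | add x y hx hy => rw [map_add, map_add, hx, hy]
    | mul x y hx hy => rw [map_mul, map_mul, hx, hy]
  exact ⟨RingEquiv.ofRingHom φ.toRingHom φ.toRingHom (RingHom.ext hinv) (RingHom.ext hinv), hφ⟩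

/-! ### Terms over a sequence of generators -/

theorem unpair_snd_lt {n : ℕ} (h : n.unpair.1 ≠ 0) : n.unpair.2 < n := by
  have h4 := Nat.add_le_pair n.unpair.1 n.unpair.2
  rw [Nat.pair_unpair] at h4
  omega

/-- The value of the `n`-th term in the generators `g 0, g 1, …` and two binary operations. The pair
`(t, k)` of which `n` is the code is read as the generator `g k` if `t = 0`, and otherwise, with `k`
coding a pair `(i, j)`, as the sum (for `t = 1`) or the product of the `i`-th and `j`-th term. -/
def termVal {X : Type*} (add mul : X → X → X) (g : ℕ → X) (n : ℕ) : X :=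
  if n.unpair.1 = 0 then g n.unpair.2
  else if n.unpair.1 = 1 then
    add (termVal add mul g n.unpair.2.unpair.1) (termVal add mul g n.unpair.2.unpair.2)
  else mul (termVal add mul g n.unpair.2.unpair.1) (termVal add mul g n.unpair.2.unpair.2)
termination_by n
decreasing_by
  all_goals
    have h1 := Nat.unpair_left_le n.unpair.2
    have h2 := Nat.unpair_right_le n.unpair.2
    have h3 : n.unpair.2 < n := unpair_snd_lt ‹_›
    omega

section termVal

variable {X Y : Type*} {add mul : X → X → X} {g : ℕ → X}

theorem termVal_gen (k : ℕ) : termVal add mul g (Nat.pair 0 k) = g k := by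
  rw [termVal]; simp

theorem termVal_add (i j : ℕ) : termVal add mul g (Nat.pair 1 (Nat.pair i j)) =
    add (termVal add mul g i) (termVal add mul g j) := by
  rw [termVal]; simp

theorem termVal_mul (i j : ℕ) : termVal add mul g (Nat.pair 2 (Nat.pair i j)) =
    mul (termVal add mul g i) (termVal add mul g j) := by
  rw [termVal]; simp

theorem map_termVal {add' mul' : Y → Y → Y} (h : X → Y)
    (hadd : ∀ x y, h (add x y) = add' (h x) (h y)) (hmul : ∀ x y, h (mul x y) = mul' (h x) (h y))
    (n : ℕ) : h (termVal add mul g n) = termVal add' mul' (fun k => h (g k)) n := by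
  induction n using Nat.strong_induction_on with
  | _ n ih =>
    rw [termVal.eq_def add mul g n, termVal.eq_def add' mul' _ n]
    split_ifs with h0 h1
    · rfl
    all_goals
      have hlt := unpair_snd_lt h0
      have hl := (Nat.unpair_left_le n.unpair.2).trans_lt hlt
      have hr := (Nat.unpair_right_le n.unpair.2).trans_lt hlt
    · rw [hadd, ih _ hl, ih _ hr]
    · rw [hmul, ih _ hl, ih _ hr]

theorem computable_termVal [Primcodable X] (hadd : Computable₂ add) (hmul : Computable₂ mul)
    (hg : Computable g) : Computable (termVal add mul g) := by
  let G : Unit → List X → Option X := fun _ l =>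
    cond (decide (l.length.unpair.1 = 0)) (some (g l.length.unpair.2))
      ((l[l.length.unpair.2.unpair.1]?).bind fun x =>
        (l[l.length.unpair.2.unpair.2]?).bind fun y =>
          some (cond (decide (l.length.unpair.1 = 1)) (add x y) (mul x y)))
  have hlen : Computable fun l : List X => l.length := Computable.list_length
  have htag : Computable fun l : List X => l.length.unpair.1 :=
    Computable.fst.comp (Computable.unpair.comp hlen)
  have harg : Computable fun l : List X => l.length.unpair.2 :=
    Computable.snd.comp (Computable.unpair.comp hlen)
  have hleft : Computable fun l : List X => l[l.length.unpair.2.unpair.1]? :=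
    Computable.list_getElem?.comp .id (Computable.fst.comp (Computable.unpair.comp harg))
  have hright : Computable fun l : List X => l[l.length.unpair.2.unpair.2]? :=
    Computable.list_getElem?.comp .id (Computable.snd.comp (Computable.unpair.comp harg))
  have hop : Computable fun p : (List X × X) × X =>
      cond (decide (p.1.1.length.unpair.1 = 1)) (add p.1.2 p.2) (mul p.1.2 p.2) := by
    have htag' : Computable fun p : (List X × X) × X => p.1.1.length.unpair.1 :=
      htag.comp (Computable.fst.comp .fst)
    exact Computable.cond (computable_beq htag' (.const 1))
      (hadd.comp (Computable.snd.comp .fst) .snd) (hmul.comp (Computable.snd.comp .fst) .snd)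
  have hbind : Computable fun p : List X × X =>
      (p.1[p.1.length.unpair.2.unpair.2]?).bind fun y =>
        some (cond (decide (p.1.length.unpair.1 = 1)) (add p.2 y) (mul p.2 y)) :=
    Computable.option_bind (hright.comp .fst) (Computable.option_some.comp hop).to₂
  have hG : Computable fun l : List X => G () l :=
    Computable.cond (computable_beq htag (.const 0))
      (Computable.option_some.comp (hg.comp harg)) (Computable.option_bind hleft hbind.to₂)
  have h := Computable.nat_strong_rec (fun _ : Unit => termVal add mul g) (g := G)
    (hG.comp .snd) fun _ n => ?_
  · exact h.comp (.const ()) .id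
  · simp only [G, List.length_map, List.length_range]
    rw [termVal]
    by_cases h0 : n.unpair.1 = 0
    · simp [h0]
    · have hlt := unpair_snd_lt h0
      have hl := (Nat.unpair_left_le n.unpair.2).trans_lt hlt
      have hr := (Nat.unpair_right_le n.unpair.2).trans_lt hlt
      by_cases h1 : n.unpair.1 = 1 <;> simp [h0, h1, hl, hr]

end termVal

/-- The sequence `x 0, y 0, x 1, y 1, …`. -/
def interleave {X : Type*} (x y : ℕ → X) (n : ℕ) : X := cond n.bodd (y n.div2) (x n.div2)

theorem interleave_even {X : Type*} (x y : ℕ → X) (n : ℕ) : interleave x y (2 * n) = x n := by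
  simp [interleave, Nat.div2_val]

theorem interleave_odd {X : Type*} (x y : ℕ → X) (n : ℕ) : interleave x y (2 * n + 1) = y n := by
  simp [interleave, Nat.div2_val]

theorem map_interleave {X Y : Type*} (h : X → Y) (x y : ℕ → X) (n : ℕ) :
    h (interleave x y n) = interleave (fun k => h (x k)) (fun k => h (y k)) n := by
  unfold interleave
  cases n.bodd <;> rfl

theorem computable_interleave {X : Type*} [Primcodable X] {x y : ℕ → X} (hx : Computable x)
    (hy : Computable y) : Computable (interleave x y) :=
  Computable.cond .nat_bodd (hy.comp .nat_div2) (hx.comp .nat_div2)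

/-- The square roots `√pₙ` with arbitrary signs, together with the negated unit fractions, generate
`ℚ(√pₙ : n ∈ C)` under addition and multiplication. -/
theorem termVal_surjective {C : Set ℕ} {x : ℕ → sqrtPrimeField C}
    (hx : ∀ n, ∃ s, x s = sqrtPrime n ∨ x s = -sqrtPrime n) :
    Function.Surjective (termVal (· + ·) (· * ·)
      (interleave x fun k => -((k : sqrtPrimeField C) + 1)⁻¹)) := by
  set T := termVal (· + ·) (· * ·) (interleave x fun k => -((k : sqrtPrimeField C) + 1)⁻¹)
  have hadd : ∀ y z, (∃ i, T i = y) → (∃ i, T i = z) → ∃ i, T i = y + z := by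
    rintro _ _ ⟨i, rfl⟩ ⟨j, rfl⟩
    exact ⟨_, termVal_add i j⟩
  have hmul : ∀ y z, (∃ i, T i = y) → (∃ i, T i = z) → ∃ i, T i = y * z := by
    rintro _ _ ⟨i, rfl⟩ ⟨j, rfl⟩
    exact ⟨_, termVal_mul i j⟩
  have hgen : ∀ s, ∃ i, T i = x s := fun s =>
    ⟨Nat.pair 0 (2 * s), (termVal_gen _).trans (interleave_even _ _ _)⟩
  have hfrac : ∀ k : ℕ, ∃ i, T i = -((k : sqrtPrimeField C) + 1)⁻¹ := fun k =>
    ⟨Nat.pair 0 (2 * k + 1), (termVal_gen _).trans (interleave_odd _ _ _)⟩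
  have hneg1 : ∃ i, T i = -1 := by simpa using hfrac 0
  have hneg : ∀ y, (∃ i, T i = y) → ∃ i, T i = -y := fun y hy => by
    simpa using hmul _ _ hneg1 hy
  have hone : ∃ i, T i = 1 := by simpa using hneg _ hneg1
  have hnat : ∀ n : ℕ, ∃ i, T i = n := by
    intro n
    induction n with
    | zero => simpa using hadd _ _ hone hneg1
    | succ n ih => simpa using hadd _ _ ih hone
  have hinv : ∀ k : ℕ, k ≠ 0 → ∃ i, T i = (k : sqrtPrimeField C)⁻¹ := by
    intro k hk
    obtain ⟨k, rfl⟩ := Nat.exists_eq_succ_of_ne_zero hk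
    simpa using hneg _ (hfrac k)
  intro y
  induction y using sqrtPrimeField_induction with
  | sqrt n =>
    obtain ⟨s, hs | hs⟩ := hx n
    · exact hs ▸ hgen s
    · simpa [hs] using hneg _ (hgen s)
  | rat q =>
    have hnum : ∃ i, T i = (q.num : sqrtPrimeField C) := by
      obtain ⟨n, hn | hn⟩ := q.num.eq_nat_or_neg
      · simpa [hn] using hnat n
      · simpa [hn] using hneg _ (hnat n)
    have := hmul _ _ hnum (hinv q.den q.den_nz)
    rwa [← div_eq_mul_inv, ← Rat.cast_def] at this
  | add y z hy hz => exact hadd y z hy hz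
  | mul y z hy hz => exact hmul y z hy hz

/-! ### Presentations from numberings -/

/-- A field has a computable presentation as soon as its elements have names, possibly several, on
which equality is decidable and the operations are computable. An element is then represented by its
least name. -/
theorem nonempty_computablePresentation_of_numbering {K : Type} [Field K] {ν : ℕ → K}
    (hν : Function.Surjective ν) {eq : ℕ → ℕ → Bool} (heqc : Computable₂ eq)
    (heq : ∀ m n, eq m n = true ↔ ν m = ν n) {add mul : ℕ → ℕ → ℕ} (haddc : Computable₂ add)
    (hmulc : Computable₂ mul) (hadd : ∀ m n, ν (add m n) = ν m + ν n)
    (hmul : ∀ m n, ν (mul m n) = ν m * ν n) : Nonempty (ComputablePresentation K) := by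
  classical
  have H : ∀ m, ∃ k, eq m k = true := fun m => ⟨m, (heq m m).2 rfl⟩
  have hrep : Computable fun m => Nat.find (H m) := Computable.natFind heqc H
  let code : K → ℕ := fun x => Nat.find (hν x)
  have hcode : ∀ x, ν (code x) = x := fun x => Nat.find_spec (hν x)
  have hrepc : ∀ m, Nat.find (H m) = code (ν m) := fun m => by
    refine le_antisymm (Nat.find_min' _ ((heq _ _).2 (hcode _).symm)) (Nat.find_min' _ ?_)
    exact ((heq _ _).1 (Nat.find_spec (H m))).symm
  refine ⟨{ code := code, code_injective := fun x y h => ?_, computable_domain := ?_,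
            computable_add := ⟨fun m n => Nat.find (H (add m n)), hrep.comp haddc, fun x y => ?_⟩
            computable_mul := ⟨fun m n => Nat.find (H (mul m n)), hrep.comp hmulc, fun x y => ?_⟩ }⟩
  · rw [← hcode x, ← hcode y, h]
  · refine computablePred_iff_bool.2
      ⟨fun n => decide (Nat.find (H n) = n), computable_beq hrep .id, fun n => ?_⟩
    rw [decide_eq_true_eq, hrepc]
    exact ⟨fun h => ⟨_, h⟩, by rintro ⟨x, rfl⟩; rw [hcode]⟩
  · exact (hrepc _).trans (by rw [hadd, hcode, hcode])
  · exact (hrepc _).trans (by rw [hmul, hcode, hcode])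

/-! ### Names for sums of square roots -/

/-- The sum of the square roots of the entries of a list. -/
noncomputable def sqrtSum (L : List ℕ) : ℝ := (L.map fun d : ℕ => √(d : ℝ)).sum

/-- The list whose square roots are the products of the square roots of the given lists. -/
def listMul (L M : List ℕ) : List ℕ := L.flatMap fun d => M.map fun e => d * e

theorem sqrtSum_append (L M : List ℕ) : sqrtSum (L ++ M) = sqrtSum L + sqrtSum M := by
  simp [sqrtSum]

theorem sqrtSum_listMul (L M : List ℕ) : sqrtSum (listMul L M) = sqrtSum L * sqrtSum M := by
  induction L with
  | nil => simp [sqrtSum, listMul]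
  | cons d L ih =>
    have h1 : sqrtSum (M.map fun e => d * e) = √d * sqrtSum M := by
      simp only [sqrtSum, List.map_map, ← List.sum_map_mul_left]
      congr 1
      refine List.map_congr_left fun e _ => ?_
      simp [Real.sqrt_mul]
    have h2 : sqrtSum (d :: L) = √d + sqrtSum L := by simp [sqrtSum]
    have h3 : listMul (d :: L) M = (M.map fun e => d * e) ++ listMul L M := by simp [listMul]
    rw [h3, sqrtSum_append, h1, h2, ih, add_mul]

theorem sqrtSum_listMul_sq (k : ℕ) (L : List ℕ) :
    sqrtSum (listMul [k * k] L) = k * sqrtSum L := by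
  rw [sqrtSum_listMul]
  simp [sqrtSum]

theorem primrec_listMul : Primrec₂ listMul :=
  Primrec.list_flatMap .fst (Primrec.list_map (Primrec.snd.comp .fst)
    (Primrec.nat_mul.comp (Primrec.snd.comp .fst) .snd).to₂).to₂

/-- The sum of the integers among the square roots `√(d * k)`, for `d` in `L`. -/
def integerPart (k : ℕ) (L : List ℕ) : ℕ :=
  (L.map fun d => if (d * k).sqrt * (d * k).sqrt = d * k then (d * k).sqrt else 0).sum

theorem primrec_integerPart : Primrec₂ integerPart := by
  have hsum : Primrec (List.sum : List ℕ → ℕ) := by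
    refine (Primrec.list_foldr (f := fun L : List ℕ => L) (g := fun _ => 0)
      (h := fun (_ : List ℕ) (p : ℕ × ℕ) => p.1 + p.2) .id (.const 0)
      (Primrec.nat_add.comp (Primrec.fst.comp .snd) (Primrec.snd.comp .snd))).of_eq fun L => ?_
    rfl
  have hdk : Primrec fun p : (ℕ × List ℕ) × ℕ => p.2 * p.1.1 :=
    Primrec.nat_mul.comp .snd (Primrec.fst.comp .fst)
  have hsq : Primrec fun p : (ℕ × List ℕ) × ℕ => (p.2 * p.1.1).sqrt := Primrec.nat_sqrt.comp hdk
  exact hsum.comp (Primrec.list_map .snd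
    (Primrec.ite (Primrec.eq.comp (Primrec.nat_mul.comp hsq hsq) hdk) hsq (.const 0)).to₂)

/-- The test whether `sqrtSum P = sqrtSum N`: the terms that become integers after multiplication
by `√k` have to cancel, for every radicand `k` that occurs. -/
def sqrtSumEq (P N : List ℕ) : Bool :=
  decide (∀ k ∈ P ++ N, integerPart k P = integerPart k N)

theorem primrec_sqrtSumEq : Primrec₂ sqrtSumEq := by
  have hR : PrimrecRel fun (k : ℕ) (p : List ℕ × List ℕ) =>
      integerPart k p.1 = integerPart k p.2 :=
    Primrec.eq.comp (primrec_integerPart.comp .fst (Primrec.fst.comp .snd))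
      (primrec_integerPart.comp .fst (Primrec.snd.comp .snd))
  exact (hR.forall_mem_list.comp (Primrec.list_append.comp .fst .snd) .id).decide

theorem sum_map_eq_sum_count {L : List ℕ} {s : Finset ℕ} (h : L.toFinset ⊆ s) (f : ℕ → ℝ) :
    (L.map f).sum = ∑ d ∈ s, (L.count d : ℝ) * f d := by
  rw [Finset.sum_list_map_count]
  simp only [nsmul_eq_mul]
  refine Finset.sum_subset h fun d _ hd => ?_
  rw [List.count_eq_zero.2 (fun h => hd (List.mem_toFinset.2 h))]
  simp

theorem integerPart_eq_sum {L : List ℕ} {s : Finset ℕ} (h : L.toFinset ⊆ s) (k : ℕ) :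
    (integerPart k L : ℝ) = ∑ d ∈ s with IsSquare (d * k), (L.count d : ℝ) * √(d * k : ℕ) := by
  rw [integerPart, Nat.cast_list_sum, List.map_map, sum_map_eq_sum_count h, Finset.sum_filter]
  refine Finset.sum_congr rfl fun d _ => ?_
  simp only [Function.comp_apply]
  by_cases hd : IsSquare (d * k)
  · obtain ⟨r, hr⟩ := hd
    simp [hr, Nat.sqrt_eq]
  · rw [if_neg hd, if_neg fun h => hd ⟨_, h.symm⟩]
    simp

theorem sqrtSumEq_iff (P N : List ℕ) : sqrtSumEq P N = true ↔ sqrtSum P = sqrtSum N := by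
  classical
  set s := (P ++ N).toFinset with hs
  have hP : P.toFinset ⊆ s := by simp [hs]
  have hN : N.toFinset ⊆ s := by simp [hs]
  have hsum : sqrtSum P - sqrtSum N =
      ∑ d ∈ s, (((P.count d : ℚ) - N.count d : ℚ) : ℝ) * √(d : ℝ) := by
    rw [sqrtSum, sqrtSum, sum_map_eq_sum_count hP, sum_map_eq_sum_count hN,
      ← Finset.sum_sub_distrib]
    exact Finset.sum_congr rfl fun d _ => by push_cast; ring
  have hint : ∀ k, (integerPart k P : ℝ) - integerPart k N = ∑ d ∈ s with IsSquare (d * k),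
      (((P.count d : ℚ) - N.count d : ℚ) : ℝ) * √(d * k : ℕ) := by
    intro k
    rw [integerPart_eq_sum hP, integerPart_eq_sum hN, ← Finset.sum_sub_distrib]
    exact Finset.sum_congr rfl fun d _ => by push_cast; ring
  rw [sqrtSumEq, decide_eq_true_eq, ← sub_eq_zero (a := sqrtSum P), hsum]
  constructor
  · intro h
    refine sum_eq_zero_of_forall_isSquare s _ (fun d => d) (fun d hd => by simp [hd])
      fun k hk hk0 => ?_
    have hk' := hint k
    rw [h k (List.mem_toFinset.1 hk), sub_self] at hk'
    simp only [Nat.cast_mul, Real.sqrt_mul (Nat.cast_nonneg _), ← mul_assoc, ← Finset.sum_mul]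
      at hk'
    exact (mul_eq_zero.1 hk'.symm).resolve_right
      (Real.sqrt_pos.2 (Nat.cast_pos.2 (Nat.pos_of_ne_zero hk0))).ne'
  · intro h k _
    have := hint k
    rw [sum_sqrt_filter_isSquare_eq_zero s _ (fun d => d) h k, sub_eq_zero] at this
    exact_mod_cast this

/-- A name `((P, N), k)` stands for the real number `(∑ d ∈ P, √d - ∑ d ∈ N, √d) / (k + 1)`. -/
abbrev SqrtName := (List ℕ × List ℕ) × ℕ

namespace SqrtName

/-- The real number with the given name. -/
noncomputable def val (x : SqrtName) : ℝ := (sqrtSum x.1.1 - sqrtSum x.1.2) / (x.2 + 1)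

/-- Addition of names. A rational factor `k` is absorbed as `k * √d = √(k * k * d)`. -/
def add (x y : SqrtName) : SqrtName :=
  ((listMul [(y.2 + 1) * (y.2 + 1)] x.1.1 ++ listMul [(x.2 + 1) * (x.2 + 1)] y.1.1,
    listMul [(y.2 + 1) * (y.2 + 1)] x.1.2 ++ listMul [(x.2 + 1) * (x.2 + 1)] y.1.2),
    (x.2 + 1) * (y.2 + 1) - 1)

/-- Multiplication of names. -/
def mul (x y : SqrtName) : SqrtName :=
  ((listMul x.1.1 y.1.1 ++ listMul x.1.2 y.1.2, listMul x.1.1 y.1.2 ++ listMul x.1.2 y.1.1),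
    (x.2 + 1) * (y.2 + 1) - 1)

/-- The test whether two names stand for the same number. -/
def eqv (x y : SqrtName) : Bool :=
  sqrtSumEq (listMul [(y.2 + 1) * (y.2 + 1)] x.1.1 ++ listMul [(x.2 + 1) * (x.2 + 1)] y.1.2)
    (listMul [(y.2 + 1) * (y.2 + 1)] x.1.2 ++ listMul [(x.2 + 1) * (x.2 + 1)] y.1.1)

theorem cast_denominator (m n : ℕ) :
    ((((m + 1) * (n + 1) - 1 : ℕ) : ℝ) + 1) = ((m : ℝ) + 1) * (n + 1) := by
  rw [Nat.cast_sub (Nat.succ_le_of_lt (by positivity))]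
  push_cast
  ring

theorem val_add (x y : SqrtName) : (add x y).val = x.val + y.val := by
  have hx : (x.2 : ℝ) + 1 ≠ 0 := by positivity
  have hy : (y.2 : ℝ) + 1 ≠ 0 := by positivity
  simp only [val, add, sqrtSum_append, sqrtSum_listMul_sq, cast_denominator]
  push_cast
  field_simp
  ring

theorem val_mul (x y : SqrtName) : (mul x y).val = x.val * y.val := by
  have hx : (x.2 : ℝ) + 1 ≠ 0 := by positivity
  have hy : (y.2 : ℝ) + 1 ≠ 0 := by positivity
  simp only [val, mul, sqrtSum_append, sqrtSum_listMul, cast_denominator]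
  field_simp
  ring

theorem eqv_iff (x y : SqrtName) : eqv x y = true ↔ x.val = y.val := by
  have hx : (x.2 : ℝ) + 1 ≠ 0 := by positivity
  have hy : (y.2 : ℝ) + 1 ≠ 0 := by positivity
  rw [eqv, sqrtSumEq_iff, val, val, div_eq_div_iff hx hy]
  simp only [sqrtSum_append, sqrtSum_listMul_sq]
  push_cast
  constructor <;> intro h <;> linarith

theorem primrec_scale {α : Type*} [Primcodable α] {f : α → ℕ} {g : α → List ℕ} (hf : Primrec f)
    (hg : Primrec g) : Primrec fun a => listMul [(f a + 1) * (f a + 1)] (g a) :=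
  primrec_listMul.comp (Primrec.list_cons.comp (Primrec.nat_mul.comp (Primrec.succ.comp hf)
    (Primrec.succ.comp hf)) (.const [])) hg

theorem primrec_fields :
    (Primrec fun p : SqrtName × SqrtName => p.1.1.1) ∧
    (Primrec fun p : SqrtName × SqrtName => p.1.1.2) ∧
    (Primrec fun p : SqrtName × SqrtName => p.1.2) ∧
    (Primrec fun p : SqrtName × SqrtName => p.2.1.1) ∧
    (Primrec fun p : SqrtName × SqrtName => p.2.1.2) ∧
    (Primrec fun p : SqrtName × SqrtName => p.2.2) :=
  ⟨Primrec.fst.comp (Primrec.fst.comp .fst), Primrec.snd.comp (Primrec.fst.comp .fst),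
    Primrec.snd.comp .fst, Primrec.fst.comp (Primrec.fst.comp .snd),
    Primrec.snd.comp (Primrec.fst.comp .snd), Primrec.snd.comp .snd⟩

theorem primrec_denominator :
    Primrec fun p : SqrtName × SqrtName => (p.1.2 + 1) * (p.2.2 + 1) - 1 :=
  Primrec.pred.comp (Primrec.nat_mul.comp (Primrec.succ.comp primrec_fields.2.2.1)
    (Primrec.succ.comp primrec_fields.2.2.2.2.2))

theorem primrec_add : Primrec₂ add := by
  obtain ⟨hP, hN, hk, hP', hN', hk'⟩ := primrec_fields
  exact ((Primrec.list_append.comp (primrec_scale hk' hP) (primrec_scale hk hP')).pair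
    (Primrec.list_append.comp (primrec_scale hk' hN) (primrec_scale hk hN'))).pair
      primrec_denominator

theorem primrec_mul : Primrec₂ mul := by
  obtain ⟨hP, hN, -, hP', hN', -⟩ := primrec_fields
  exact ((Primrec.list_append.comp (primrec_listMul.comp hP hP') (primrec_listMul.comp hN hN')).pair
    (Primrec.list_append.comp (primrec_listMul.comp hP hN') (primrec_listMul.comp hN hP'))).pair
      primrec_denominator

theorem primrec_eqv : Primrec₂ eqv := by
  obtain ⟨hP, hN, hk, hP', hN', hk'⟩ := primrec_fields
  exact primrec_sqrtSumEq.comp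
    (Primrec.list_append.comp (primrec_scale hk' hP) (primrec_scale hk hN'))
    (Primrec.list_append.comp (primrec_scale hk' hN) (primrec_scale hk hP'))

end SqrtName

/-- If `c` enumerates `C`, the elements of `ℚ(√pₙ : n ∈ C)` are numbered by terms in the generators,
and the names of these terms decide equality. -/
theorem nonempty_computablePresentation_sqrtPrimeField {c : ℕ → ℕ} (hc : Computable c) :
    Nonempty (ComputablePresentation (sqrtPrimeField (Set.range c))) := by
  let K := sqrtPrimeField (Set.range c)
  let x : ℕ → K := enumSqrt c
  let gen : ℕ → K := interleave x fun k => -((k : K) + 1)⁻¹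
  let ν : ℕ → K := termVal (· + ·) (· * ·) gen
  have hν : Function.Surjective ν := termVal_surjective fun n => by
    obtain ⟨s, hs⟩ := exists_enumSqrt_eq n
    exact ⟨s, Or.inl hs⟩
  let gname : ℕ → SqrtName := interleave (fun s => (([Nat.nth Nat.Prime (c s)], []), 0))
    fun k => (([], [1]), k)
  have hgname : Computable gname := by
    refine computable_interleave ?_ ?_
    · exact ((Computable.list_cons.comp (computable_nth_prime.comp hc) (.const [])).pair
        (.const [])).pair (.const 0)
    · exact (Computable.const _).pair .id
  have hgval : ∀ k, (gname k).val = (gen k : ℝ) := by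
    intro k
    rw [map_interleave SqrtName.val, map_interleave (fun y : K => (y : ℝ))]
    congr 1
    · ext s
      simp [SqrtName.val, sqrtSum, x, enumSqrt, coe_sqrtPrime]
    · ext s
      simp [SqrtName.val, sqrtSum, neg_div]
  let name : ℕ → SqrtName := termVal SqrtName.add SqrtName.mul gname
  have hname : Computable name :=
    computable_termVal SqrtName.primrec_add.to_comp SqrtName.primrec_mul.to_comp hgname
  have hval : ∀ n, (name n).val = (ν n : ℝ) := by
    intro n
    rw [map_termVal SqrtName.val SqrtName.val_add SqrtName.val_mul,
      map_termVal (add' := (· + ·)) (mul' := (· * ·)) (fun y : K => (y : ℝ)) (fun _ _ => rfl)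
        fun _ _ => rfl]
    simp only [hgval]
  refine nonempty_computablePresentation_of_numbering hν
    (eq := fun m n => SqrtName.eqv (name m) (name n))
    (add := fun m n => Nat.pair 1 (Nat.pair m n)) (mul := fun m n => Nat.pair 2 (Nat.pair m n))
    (SqrtName.primrec_eqv.to_comp.comp (hname.comp .fst) (hname.comp .snd)) (fun m n => ?_)
    (Primrec₂.natPair.to_comp.comp (.const 1) (Primrec₂.natPair.to_comp.comp .fst .snd))
    (Primrec₂.natPair.to_comp.comp (.const 2) (Primrec₂.natPair.to_comp.comp .fst .snd))
    termVal_add termVal_mul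
  rw [SqrtName.eqv_iff, hval, hval]
  exact Subtype.ext_iff.symm

/-! ### Computing in a presented field -/

namespace ComputablePresentation

variable {K : Type} [Field K] (P : ComputablePresentation K)

/-- A computable test on codes which some element passes at every stage is passed by a computable
sequence of elements. -/
theorem exists_search {test : ℕ → ℕ → Bool} (ht : Computable₂ test)
    (H : ∀ s, ∃ x, test s (P.code x) = true) :
    ∃ y : ℕ → K, (Computable fun s => P.code (y s)) ∧ ∀ s, test s (P.code (y s)) = true := by
  obtain ⟨dom, hdom, hd⟩ := computablePred_iff_bool.1 P.computable_domain
  have hsearch : Computable₂ fun s m => dom m && test s m :=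
    Primrec.and.to_comp.comp (hdom.comp .snd) ht
  obtain ⟨g, hg, hgs⟩ := hsearch.exists_search fun s => by
    obtain ⟨x, hx⟩ := H s
    exact ⟨P.code x, by rw [Bool.and_eq_true]; exact ⟨(hd _).2 ⟨x, rfl⟩, hx⟩⟩
  simp only [Bool.and_eq_true, hd] at hgs
  choose y hy using fun s => (hgs s).1
  exact ⟨y, hg.of_eq fun s => (hy s).symm, fun s => (hy s).symm ▸ (hgs s).2⟩

theorem computable_natCast : Computable fun n : ℕ => P.code (n : K) := by
  obtain ⟨f, hf, hadd⟩ := P.computable_add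
  refine (Computable.nat_rec (f := fun n : ℕ => n) (g := fun _ => P.code 0)
    (h := fun (_ : ℕ) (p : ℕ × ℕ) => f p.2 (P.code 1)) .id (.const _)
    (hf.comp (Computable.snd.comp .snd) (.const _))).of_eq fun n => ?_
  induction n with
  | zero => simp
  | succ n ih =>
    rw [Nat.cast_succ, ← hadd, ← ih]

theorem computable_neg {y : ℕ → K} (hy : Computable fun s => P.code (y s)) :
    Computable fun s => P.code (-y s) := by
  obtain ⟨f, hf, hmul⟩ := P.computable_mul
  refine (hf.comp (Computable.const (P.code (-1))) hy).of_eq fun s => ?_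
  rw [hmul, neg_one_mul]

theorem exists_computable_sqrt {a : ℕ → ℕ} (ha : Computable a) (H : ∀ s, ∃ x : K, x * x = a s) :
    ∃ y : ℕ → K, (Computable fun s => P.code (y s)) ∧ ∀ s, y s * y s = a s := by
  obtain ⟨f, hf, hmul⟩ := P.computable_mul
  have ht : Computable₂ fun s m => decide (f m m = P.code (a s : K)) :=
    computable_beq (hf.comp .snd .snd) ((P.computable_natCast.comp ha).comp .fst)
  obtain ⟨y, hy, hys⟩ := P.exists_search ht fun s => by
    obtain ⟨x, hx⟩ := H s
    exact ⟨x, by rw [decide_eq_true_eq, hmul, hx]⟩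
  refine ⟨y, hy, fun s => P.code_injective ?_⟩
  rw [← hmul]
  exact of_decide_eq_true (hys s)

theorem computable_neg_unitFraction [CharZero K] :
    Computable fun k : ℕ => P.code (-((k : K) + 1)⁻¹) := by
  obtain ⟨f, hf, hmul⟩ := P.computable_mul
  have ht : Computable₂ fun k m => decide (f (P.code ((k + 1 : ℕ) : K)) m = P.code 1) :=
    computable_beq (hf.comp ((P.computable_natCast.comp .succ).comp .fst) .snd) (.const _)
  have hne : ∀ k : ℕ, (k : K) + 1 ≠ 0 := Nat.cast_add_one_ne_zero
  obtain ⟨y, hy, hys⟩ := P.exists_search ht fun k =>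
    ⟨((k : K) + 1)⁻¹, by rw [decide_eq_true_eq, hmul, Nat.cast_succ, mul_inv_cancel₀ (hne k)]⟩
  refine (P.computable_neg hy).of_eq fun k => ?_
  have := of_decide_eq_true (hys k)
  rw [hmul, Nat.cast_succ] at this
  rw [eq_inv_of_mul_eq_one_right (P.code_injective this)]

/-- An automorphism is computable as soon as it is computable on a generating sequence. -/
theorem isComputableMap_of_generators {α : K ≃+* K} {g : ℕ → K}
    (hg : Computable fun s => P.code (g s)) (hαg : Computable fun s => P.code (α (g s)))
    (hsurj : Function.Surjective (termVal (· + ·) (· * ·) g)) : IsComputableMap P P α := by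
  obtain ⟨f, hf, hadd⟩ := P.computable_add
  obtain ⟨f', hf', hmul⟩ := P.computable_mul
  obtain ⟨dom, hdom, hd⟩ := computablePred_iff_bool.1 P.computable_domain
  have hT : ∀ n, P.code (termVal (· + ·) (· * ·) g n) = termVal f f' (fun s => P.code (g s)) n :=
    map_termVal P.code (fun x y => (hadd x y).symm) fun x y => (hmul x y).symm
  have hT' : ∀ n, P.code (α (termVal (· + ·) (· * ·) g n)) =
      termVal f f' (fun s => P.code (α (g s))) n :=
    map_termVal (fun x => P.code (α x)) (fun x y => by rw [map_add, hadd])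
      fun x y => by rw [map_mul, hmul]
  -- Off the codes the search below stops at once.
  have hsearch : Computable₂ fun m n =>
      !dom m || decide (termVal f f' (fun s => P.code (g s)) n = m) :=
    Primrec.or.to_comp.comp (Primrec.not.to_comp.comp (hdom.comp .fst))
      (computable_beq ((computable_termVal hf hf' hg).comp .snd) .fst)
  obtain ⟨t, ht, hts⟩ := hsearch.exists_search fun m => by
    by_cases hm : dom m = true
    · obtain ⟨x, rfl⟩ := (hd m).1 hm
      obtain ⟨n, rfl⟩ := hsurj x
      exact ⟨n, by simp [hT]⟩
    · exact ⟨0, by simp [hm]⟩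
  refine ⟨_, (computable_termVal hf hf' hαg).comp ht, fun x => ?_⟩
  have h1 := hts (P.code x)
  rw [(hd _).2 ⟨x, rfl⟩, Bool.not_true, Bool.false_or, decide_eq_true_eq, ← hT] at h1
  rw [← hT', P.code_injective h1]

end ComputablePresentation

/-- Given a computable colouring `σ` of an enumeration `c` of `C`, the automorphism which negates
`√pₙ` for the `n` of colour `true` and fixes it for the others is computable in every computable
presentation. -/
theorem exists_computable_signed_automorphism {c : ℕ → ℕ} {σ : ℕ → Bool} (hc : Computable c)
    (hσ : Computable σ) (hcσ : ∀ s t, c s = c t → σ s = σ t)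
    (P : ComputablePresentation (sqrtPrimeField (Set.range c))) :
    ∃ α : sqrtPrimeField (Set.range c) ≃+* sqrtPrimeField (Set.range c), IsComputableMap P P α ∧
      ∀ s, α (enumSqrt c s) =
        cond (σ s) (-enumSqrt c s) (enumSqrt c s) := by
  let K := sqrtPrimeField (Set.range c)
  choose t ht using fun n : Set.range c => n.2
  obtain ⟨α, hα⟩ := exists_signed_automorphism fun n : Set.range c => cond (σ (t n)) (-1 : ℤˣ) 1
  have hα' : ∀ s, α (enumSqrt c s) =
      cond (σ s) (-enumSqrt c s) (enumSqrt c s) := by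
    intro s
    rw [enumSqrt, hα, hcσ _ s (ht ⟨c s, s, rfl⟩)]
    cases σ s <;> simp
  refine ⟨α, ?_, hα'⟩
  obtain ⟨x, hx, hxs⟩ := P.exists_computable_sqrt (computable_nth_prime.comp hc)
    fun s => ⟨enumSqrt c s, enumSqrt_mul_self c s⟩
  have hxx : ∀ s, x s = enumSqrt c s ∨ x s = -enumSqrt c s := fun s =>
    mul_self_eq_mul_self_iff.1 ((hxs s).trans (enumSqrt_mul_self c s).symm)
  have hαx : ∀ s, α (x s) = cond (σ s) (-x s) (x s) := by
    intro s
    rcases hxx s with h | h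
    · simp only [h, hα']
    · simp only [h, map_neg, hα']
      cases σ s <;> rfl
  refine P.isComputableMap_of_generators (g := interleave x fun k => -((k : K) + 1)⁻¹) ?_ ?_
    (termVal_surjective fun n => ?_)
  · exact (computable_interleave hx P.computable_neg_unitFraction).of_eq fun n =>
      (map_interleave P.code _ _ n).symm
  · have hαc : Computable fun s => P.code (α (x s)) :=
      (Computable.cond hσ (P.computable_neg hx) hx).of_eq fun s => by
        rw [hαx]; cases σ s <;> rfl
    refine (computable_interleave hαc P.computable_neg_unitFraction).of_eq fun n => ?_
    rw [map_interleave fun y => P.code (α y)]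
    simp
  · obtain ⟨s, hs⟩ := exists_enumSqrt_eq n
    exact ⟨s, hs ▸ hxx s⟩

/-! ### The extension of the automorphism -/

/-- `ℚ(√pₙ : n ∈ C)` is a computable field, and in none of its computable presentations does it
have the computable extendability of automorphisms property. -/
theorem proposition4p3 (C : Set ℕ) (hCe : REPred fun n : ℕ => n ∈ C)
    (hnc : ¬ ComputablePred fun n : ℕ => n ∈ C) :
    Nonempty (ComputablePresentation (sqrtPrimeField C)) ∧
      ∀ P : ComputablePresentation (sqrtPrimeField C),
        ¬ ComputableExtendabilityOfAutomorphisms P := by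
  obtain ⟨c, σ, hc, rfl, hσ, hcσ, hsep⟩ := exists_inseparable_splitting hCe hnc
  refine ⟨nonempty_computablePresentation_sqrtPrimeField hc, fun P hP => ?_⟩
  obtain ⟨α, hαc, hα⟩ := exists_computable_signed_automorphism hc hσ hcσ P
  obtain ⟨E, _, Q, i, β, hi, ⟨b, hb, hbβ⟩, hβi⟩ := hP α hαc
  have := hi.isAlgClosed
  have : CharZero E := charZero_of_injective_ringHom i.injective
  obtain ⟨z, hz, hzn⟩ := Q.exists_computable_sqrt computable_nth_prime fun n => by
    obtain ⟨x, hx⟩ := IsAlgClosed.exists_pow_nat_eq (Nat.nth Nat.Prime n : E) two_pos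
    exact ⟨x, by rw [← sq, hx]⟩
  -- The primes whose square roots are negated by `β` separate the two halves of the splitting.
  obtain ⟨s, hs⟩ := hsep (fun n => decide (b (Q.code (z n)) = Q.code (-z n)))
    (computable_beq (hb.comp hz) (Q.computable_neg hz))
  have hβ : β (z (c s)) = cond (σ s) (-z (c s)) (z (c s)) := by
    have hsq : z (c s) * z (c s) = i (enumSqrt c s) * i (enumSqrt c s) := by
      rw [← map_mul, enumSqrt_mul_self, map_natCast, hzn]
    rcases mul_self_eq_mul_self_iff.1 hsq with h | h <;> rw [h] <;>
      simp only [map_neg, hβi, hα] <;> cases σ s <;> simp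
  refine hs ?_
  rw [hbβ, hβ]
  cases σ s with
  | true => simp
  | false =>
    have hz0 : z (c s) ≠ 0 := fun h => by
      have := hzn (c s)
      rw [h, zero_mul] at this
      exact (Nat.prime_nth_prime (c s)).ne_zero (by exact_mod_cast this.symm)
    simp only [cond_false, decide_eq_false_iff_not]
    exact fun h => hz0 (self_eq_neg.1 (Q.code_injective h))
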